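/- Let $p_+,p_-\geq 1$ be coprime integers with $p_+\neq p_-$, and put $\alpha=\sqrt{2p_+p_-}$ and $\alpha_0=\sqrt{2p_- /p_+}-\sqrt{2p_+/p_-}$. For $\tau$ in the upper half-plane write $q^s=e^{2\pi i\tau s}$ for $s\in\mathbb{C}$, and let $\eta$ be the Dedekind eta function. For $a\in\mathbb{N}$, $a\ge 1$, $b\in\mathbb{Z}$ and $u,\epsilon\in\mathbb{C}$ let $$\theta_{a,b}(u,\tau)=\sum_{k\in\mathbb{Z}}e^{2\pi i u(k+\frac{b}{2a})}q^{a(k+\frac{b}{2a})^2},\qquad P^{\epsilon}_{a,b}(u,\tau)=\sum_{k\geq 0}e^{2\pi\epsilon(k+\frac{b}{2a})}e^{2\pi i u(k+\frac{b}{2a})}q^{a(k+\frac{b}{2a})^2}.$$ Let the regularised character of the Fock module $\mathcal{F}_\lambda$, $\lambda\in\mathbb{C}$, be $$\mathrm{ch}[\mathcal{F}^\epsilon_\lambda](\tau)=e^{2\pi\epsilon(\lambda-\alpha_0/2)}\,\frac{q^{(\lambda-\alpha_0/2)^2/2}}{\eta(\tau)},$$ and, for $b,c\in\mathbb{Z}$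 with $c\neq 0$, let the mixed false theta function be $$F^\epsilon_{b,c}(\tau)=\frac{1}{\eta(\tau)}\left(P^{-\alpha\epsilon}_{p_+p_-,\,b-c}(0,\tau)-P^{-\alpha\epsilon}_{p_+p_-,\,b+c}(0,\tau)\right).$$ Then for every $\epsilon\in\mathbb{C}\setminus i\mathbb{R}$ and every $\tau$ in the upper half-plane the integral below converges absolutely and $$F^\epsilon_{b,c}\left(-\frac1\tau\right)=\int_{\mathbb{R}}S^\epsilon_{b,c}(x)\,\mathrm{ch}[\mathcal{F}^\epsilon_{x+\alpha_0/2}](\tau)\,dx+\frac{1-\operatorname{sgn}\operatorname{Re}(\epsilon)}{2}\,X^\epsilon_{b,c}(\tau),$$ where the $S$-kernel is $$S^\epsilon_{b,c}(x)=e^{-2\pi\epsilon x}\,e^{2\pi i\frac{b-p_+p_-}{\alpha}(x+i\epsilon)}\,\frac{\sin\left(2\pi c\,\frac{x+i\epsilon}{\alpha}\right)}{\sin\left(\pi\alpha(x+i\epsilon)\right)}$$ and the correction term is $$X^\epsilon_{b,c}(\tau)=\frac{2i\,q^{-\epsilon^2/2}}{\alpha}\sum_{m=0}^{2p_+p_--1}e^{-\pi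 i\frac{bm}{p_+p_-}}\sin\left(\pi\frac{cm}{p_+p_-}\right)\frac{\theta_{p_+p_-,m}(i\alpha\epsilon\tau,\tau)}{\eta(\tau)}.$$ -/

import Mathlib

open MeasureTheory

noncomputable section

namespace Singlet

/-- The power `q ^ s = e ^ (2 π i τ s)` of the nome `q = e ^ (2 π i τ)`, with complex exponent. -/
def qPow (τ s : ℂ) : ℂ := Complex.exp (2 * Real.pi * Complex.I * τ * s)

/-- The Jacobi theta function
`θ_{a,b}(u, τ) = ∑_{k ∈ ℤ} z ^ (k + b / 2a) q ^ (a (k + b / 2a) ^ 2)`,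
where `q = e ^ (2 π i τ)` and `z = e ^ (2 π i u)`. -/
def theta (a : ℕ) (b : ℤ) (u τ : ℂ) : ℂ :=
  ∑' k : ℤ, Complex.exp (2 * Real.pi * Complex.I * u * ((k : ℂ) + (b : ℂ) / (2 * (a : ℂ)))) *
    qPow τ ((a : ℂ) * ((k : ℂ) + (b : ℂ) / (2 * (a : ℂ))) ^ 2)

/-- The `ε`-regularised partial theta function
`P^ε_{a,b}(u, τ) = ∑_{k ≥ 0} e ^ (2 π ε (b / 2a + k)) z ^ (b / 2a + k) q ^ (a (b / 2a + k) ^ 2)`. -/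
def regPartialTheta (ε : ℂ) (a : ℕ) (b : ℤ) (u τ : ℂ) : ℂ :=
  ∑' k : ℕ, Complex.exp (2 * Real.pi * ε * ((b : ℂ) / (2 * (a : ℂ)) + (k : ℂ))) *
    Complex.exp (2 * Real.pi * Complex.I * u * ((b : ℂ) / (2 * (a : ℂ)) + (k : ℂ))) *
    qPow τ ((a : ℂ) * ((b : ℂ) / (2 * (a : ℂ)) + (k : ℂ)) ^ 2)

/-- `α = √(2 p₊ p₋)`. -/
def alpha (pp pm : ℕ) : ℝ := Real.sqrt (2 * (pp : ℝ) * (pm : ℝ))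

/-- `α₀ = α₊ + α₋` with `α₊ = √(2 p₋ / p₊)` and `α₋ = - √(2 p₊ / p₋)`. -/
def alphaZero (pp pm : ℕ) : ℝ :=
  Real.sqrt (2 * (pm : ℝ) / (pp : ℝ)) + -Real.sqrt (2 * (pp : ℝ) / (pm : ℝ))

/-- The regularised character of the Fock module of highest weight `w`, namely
`ch[F_w^ε](τ) = e ^ (2 π ε (w - α₀ / 2)) q ^ ((w - α₀ / 2) ^ 2 / 2) / η(τ)`. -/
def fockChar (pp pm : ℕ) (ε w τ : ℂ) : ℂ :=
  Complex.exp (2 * Real.pi * ε * (w - (alphaZero pp pm : ℂ) / 2)) *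
    (qPow τ ((w - (alphaZero pp pm : ℂ) / 2) ^ 2 / 2) / ModularForm.eta τ)

/-- The mixed false theta function
`F^ε_{b,c}(τ) = (P^{-αε}_{p₊p₋,b-c}(0, τ) - P^{-αε}_{p₊p₋,b+c}(0, τ)) / η(τ)`. -/
def mixedFalseTheta (pp pm : ℕ) (ε : ℂ) (b c : ℤ) (τ : ℂ) : ℂ :=
  1 / ModularForm.eta τ *
    (regPartialTheta (-(alpha pp pm : ℂ) * ε) (pp * pm) (b - c) 0 τ -
      regPartialTheta (-(alpha pp pm : ℂ) * ε) (pp * pm) (b + c) 0 τ)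

/-- The `S`-kernel
`S^ε_{b,c}(x) = e ^ (-2 π ε x) e ^ (2 π i (b - p₊p₋) (x + iε) / α)
  sin (2 π c (x + iε) / α) / sin (π α (x + iε))`. -/
def sKernel (pp pm : ℕ) (ε : ℂ) (b c : ℤ) (x : ℝ) : ℂ :=
  Complex.exp (-2 * Real.pi * ε * (x : ℂ)) *
    Complex.exp (2 * Real.pi * Complex.I *
      (((b : ℂ) - (pp : ℂ) * (pm : ℂ)) / (alpha pp pm : ℂ)) * ((x : ℂ) + Complex.I * ε)) *
    (Complex.sin (2 * Real.pi * (c : ℂ) * (((x : ℂ) + Complex.I * ε) / (alpha pp pm : ℂ))) /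
      Complex.sin (Real.pi * (alpha pp pm : ℂ) * ((x : ℂ) + Complex.I * ε)))

/-- The correction term
`X^ε_{b,c}(τ) = (2 i q ^ (-ε ^ 2 / 2) / α) ∑_{m=0}^{2p₊p₋-1}
  e ^ (-π i b m / p₊p₋) sin (π c m / p₊p₋) θ_{p₊p₋,m}(i α ε τ, τ) / η(τ)`. -/
def correction (pp pm : ℕ) (ε : ℂ) (b c : ℤ) (τ : ℂ) : ℂ :=
  2 * Complex.I * qPow τ (-ε ^ 2 / 2) / (alpha pp pm : ℂ) *
    ∑ m ∈ Finset.range (2 * pp * pm),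
      Complex.exp (-Real.pi * Complex.I *
          ((b : ℂ) * (m : ℂ) / ((pp : ℂ) * (pm : ℂ)))) *
        Complex.sin (Real.pi * ((c : ℂ) * (m : ℂ) / ((pp : ℂ) * (pm : ℂ)))) *
        (theta (pp * pm) (m : ℤ) (Complex.I * (alpha pp pm : ℂ) * ε * τ) τ / ModularForm.eta τ)

end Singlet

end

/-!
At `-1 / τ` the partial theta functions are sums over `y = α k + (b ∓ c) / α`, `k ≥ 0`, of
`e ^ (-2 π ε y) e ^ (-π i y ^ 2 / τ)` (`Singlet.regPartialTheta_neg_one_div`). Each summand is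
`√(-iτ)` times the Gaussian integral of `e ^ (π i τ x ^ 2) e ^ (2 π i y (x + i ε))` over `x ∈ ℝ`
(`Singlet.integral_waveTerm`), and this `√(-iτ)` cancels against the one in
`η(-1 / τ) = √(-iτ) η(τ)` (`Singlet.eta_neg_one_div`).

For `Re ε > 0` the sum over `k` may be taken under the integral, where it is a geometric series in
`e ^ (2 π i α (x + i ε))`, a number whose modulus is less than one and independent of `x`
(`Singlet.hasSum_dualTerm`).
The difference of the two closed forms is the kernel times the character
(`Singlet.sKernel_mul_fockChar`), and no correction arises.

For `Re ε < 0` that geometric series diverges, but the one over `k < 0` converges and has the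
opposite closed form (`Singlet.waveSum_neg`). So the sum over `k ≥ 0` is the same integral plus the
sum over all `k ∈ ℤ` (`Singlet.tsum_dualTerm_of_re_neg`). The functional equation of the Jacobi
theta function evaluates this two-sided sum (`Singlet.hasSum_int_dualTerm`), and splitting the result
into residue classes modulo `2 p₊ p₋` gives the correction term (`Singlet.correction_eq`).
-/

open Complex (I I_sq I_ne_zero I_pow_three)
open scoped Real Complex

namespace Singlet

/-! ### Gaussians and their geometric sums -/

/-- `e ^ (-2 π ε y) e ^ (-π i y ^ 2 / τ)`, the summand of a regularised partial theta function at
`-1 / τ`, as a function of the real exponent `y`. -/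
noncomputable def dualTerm (ε τ : ℂ) (y : ℝ) : ℂ :=
  cexp (-2 * π * ε * y - π * I * (y : ℂ) ^ 2 / τ)

/-- `e ^ (π i τ x ^ 2) e ^ (2 π i y (x + i ε))`, whose integral over `x ∈ ℝ` is, up to a constant,
`dualTerm ε τ y`. -/
noncomputable def waveTerm (ε τ : ℂ) (y x : ℝ) : ℂ :=
  cexp (π * I * τ * (x : ℂ) ^ 2 + 2 * π * I * y * (x + I * ε))

/-- The closed form of the geometric series `∑ k ≥ 0, waveTerm ε τ (s k + β) x`. It is the sum of
the series only when `0 < s * ε.re`, but it is meaningful whenever `s * ε.re ≠ 0`. -/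
noncomputable def waveSum (ε τ : ℂ) (s β x : ℝ) : ℂ :=
  waveTerm ε τ β x / (1 - cexp (2 * π * I * s * (x + I * ε)))

/-! ### Square roots and the inversion formula for `η` -/

/-- The inversion formula for `η`, with the multiplier written as a single principal square
root. -/
lemma eta_neg_one_div {τ : ℂ} (hτ : 0 < τ.im) :
    ModularForm.eta (-1 / τ) = (-I * τ) ^ (1 / 2 : ℂ) * ModularForm.eta τ := by
  have hτ0 : τ ≠ 0 := by rintro rfl; simp at hτ
  have h := ModularForm.eta_comp_eq_csqrt_I_inv (show τ ∈ UpperHalfPlane.upperHalfPlaneSet from hτ)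
  simp only [Function.comp_apply, Pi.smul_apply, Pi.mul_apply, smul_eq_mul, Complex.sqrt] at h
  rw [h, ← mul_assoc]
  congr 1
  -- The factorisation `τ = I * (-I * τ)` is compatible with principal arguments because
  -- `-I * τ` lies in the right half-plane.
  have hre : 0 < (-I * τ).re := by simpa using hτ
  have harg := abs_lt.mp (Complex.abs_arg_lt_pi_div_two_iff.mpr (Or.inl hre))
  have hsplit : τ ^ (1 / 2 : ℂ) = I ^ (1 / 2 : ℂ) * (-I * τ) ^ (1 / 2 : ℂ) := by
    have hτ' : -I * τ ≠ 0 := mul_ne_zero (neg_ne_zero.mpr I_ne_zero) hτ0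
    have hlog : Complex.log τ = Complex.log I + Complex.log (-I * τ) := by
      rw [← Complex.log_mul I_ne_zero hτ']
      · rw [← mul_assoc]; simp
      · rw [Complex.arg_I]
        constructor <;> linarith [harg.1, harg.2, Real.pi_pos]
    rw [Complex.cpow_def_of_ne_zero hτ0, Complex.cpow_def_of_ne_zero I_ne_zero,
      Complex.cpow_def_of_ne_zero hτ', ← Complex.exp_add, ← add_mul, hlog]
  have hI : I ^ (1 / 2 : ℂ) ≠ 0 := by simp [Complex.cpow_eq_zero_iff]
  have e : (2⁻¹ : ℂ) = 1 / 2 := by norm_num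
  simp only [e] at *
  rw [hsplit]
  field_simp

lemma cpow_half_ne_zero {τ : ℂ} (hτ : 0 < τ.im) : (-I * τ) ^ (1 / 2 : ℂ) ≠ 0 := by
  have hτ0 : τ ≠ 0 := by rintro rfl; simp at hτ
  simp [Complex.cpow_eq_zero_iff, hτ0]

lemma inv_cpow_half {τ : ℂ} (hτ : 0 < τ.im) :
    ((-I * τ)⁻¹) ^ (1 / 2 : ℂ) = ((-I * τ) ^ (1 / 2 : ℂ))⁻¹ := by
  apply Complex.inv_cpow
  have hre : 0 < (-I * τ).re := by simpa using hτ
  have harg := abs_lt.mp (Complex.abs_arg_lt_pi_div_two_iff.mpr (Or.inl hre))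
  linarith [Real.pi_pos]

/-! ### Gaussian integrals and termwise integration -/

lemma norm_waveTerm (ε τ : ℂ) (y x : ℝ) :
    ‖waveTerm ε τ y x‖ = Real.exp (-2 * π * ε.re * y) * Real.exp (-(π * τ.im) * x ^ 2) := by
  rw [waveTerm, Complex.norm_exp, ← Real.exp_add]
  congr 1
  have hx : (x : ℂ) ^ 2 = ((x ^ 2 : ℝ) : ℂ) := by push_cast; rfl
  simp [hx, -Complex.ofReal_pow]
  ring

lemma continuous_waveTerm (ε τ : ℂ) (y : ℝ) : Continuous (waveTerm ε τ y) := by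
  unfold waveTerm; fun_prop

lemma integrable_waveTerm {τ : ℂ} (hτ : 0 < τ.im) (ε : ℂ) (y : ℝ) :
    Integrable (waveTerm ε τ y) := by
  rw [← integrable_norm_iff (continuous_waveTerm ε τ y).aestronglyMeasurable]
  simp only [norm_waveTerm]
  exact (integrable_exp_neg_mul_sq (mul_pos Real.pi_pos hτ)).const_mul _

lemma integral_waveTerm {τ : ℂ} (hτ : 0 < τ.im) (ε : ℂ) (y : ℝ) :
    ∫ x : ℝ, waveTerm ε τ y x = ((-I * τ) ^ (1 / 2 : ℂ))⁻¹ * dualTerm ε τ y := by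
  have hτ0 : τ ≠ 0 := by rintro rfl; simp at hτ
  have hπ : (π : ℂ) ≠ 0 := by exact_mod_cast Real.pi_ne_zero
  have hb : (π * I * τ).re < 0 := by
    have : (π * I * τ).re = -(π * τ.im) := by simp
    rw [this]; exact neg_neg_of_pos (mul_pos Real.pi_pos hτ)
  have h := integral_cexp_quadratic hb (2 * π * I * y) (-2 * π * ε * y)
  have e1 : (π : ℂ) / -(π * I * τ) = (-I * τ)⁻¹ := by field_simp
  have e2 : -2 * π * ε * y - (2 * π * I * y) ^ 2 / (4 * (π * I * τ)) =
      -2 * π * ε * y - π * I * (y : ℂ) ^ 2 / τ := by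
    field_simp
    ring
  rw [e1, e2, inv_cpow_half hτ] at h
  rw [dualTerm, ← h]
  congr 1
  ext x
  rw [waveTerm]
  congr 1
  linear_combination 2 * (π : ℂ) * y * ε * I_sq

lemma waveTerm_arith (ε τ : ℂ) (s β x : ℝ) (k : ℕ) :
    waveTerm ε τ (s * k + β) x =
      waveTerm ε τ β x * cexp (2 * π * I * s * (x + I * ε)) ^ k := by
  rw [waveTerm, waveTerm, ← Complex.exp_nat_mul, ← Complex.exp_add]
  congr 1
  push_cast
  ring

lemma norm_exp_two_pi_I_mul (ε : ℂ) (s x : ℝ) :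
    ‖cexp (2 * π * I * s * (x + I * ε))‖ = Real.exp (-(2 * π * (s * ε.re))) := by
  rw [Complex.norm_exp]
  congr 1
  simp
  ring

lemma norm_exp_two_pi_I_mul_lt_one {ε : ℂ} {s : ℝ} (hs : 0 < s * ε.re) (x : ℝ) :
    ‖cexp (2 * π * I * s * (x + I * ε))‖ < 1 := by
  rw [norm_exp_two_pi_I_mul, Real.exp_lt_one_iff]
  have := mul_pos Real.two_pi_pos hs
  linarith

lemma one_sub_exp_ne_zero {ε : ℂ} (hε : ε.re ≠ 0) {s : ℝ} (hs : s ≠ 0) (x : ℝ) :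
    1 - cexp (2 * π * I * s * (x + I * ε)) ≠ 0 := by
  intro h
  have h1 := norm_exp_two_pi_I_mul ε s x
  rw [← sub_eq_zero.mp h, norm_one, eq_comm, Real.exp_eq_one_iff] at h1
  have : 2 * π * (s * ε.re) ≠ 0 := by positivity
  exact this (by linarith)

lemma hasSum_waveTerm {ε : ℂ} {s : ℝ} (hs : 0 < s * ε.re) (τ : ℂ) (β x : ℝ) :
    HasSum (fun k : ℕ => waveTerm ε τ (s * k + β) x) (waveSum ε τ s β x) := by
  simp only [waveTerm_arith, waveSum, div_eq_mul_inv]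
  exact (hasSum_geometric_of_norm_lt_one (norm_exp_two_pi_I_mul_lt_one hs x)).mul_left _

lemma integrable_waveSum {ε τ : ℂ} (hτ : 0 < τ.im) {s : ℝ} (hs : 0 < s * ε.re) (β : ℝ) :
    Integrable (waveSum ε τ s β) := by
  have hε : ε.re ≠ 0 := right_ne_zero_of_mul hs.ne'
  have hs0 : s ≠ 0 := left_ne_zero_of_mul hs.ne'
  have hr : Real.exp (-(2 * π * (s * ε.re))) < 1 := by
    rw [← norm_exp_two_pi_I_mul ε s 0]; exact norm_exp_two_pi_I_mul_lt_one hs 0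
  have hcont : Continuous fun x : ℝ => (1 - cexp (2 * π * I * s * (x + I * ε)))⁻¹ :=
    Continuous.inv₀ (by fun_prop) (one_sub_exp_ne_zero hε hs0)
  refine (integrable_waveTerm hτ ε β).mul_bdd (c := (1 - Real.exp (-(2 * π * (s * ε.re))))⁻¹)
    hcont.aestronglyMeasurable (Filter.Eventually.of_forall fun x => ?_)
  rw [norm_inv]
  refine inv_anti₀ (by linarith) ?_
  have := norm_sub_norm_le (1 : ℂ) (cexp (2 * π * I * s * (x + I * ε)))
  rwa [norm_one, norm_exp_two_pi_I_mul] at this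

/-- Termwise integration of the geometric series of Gaussians, legitimate because the norms of the
summands do not oscillate: they are a geometric sequence times a fixed Gaussian. -/
lemma hasSum_dualTerm {ε τ : ℂ} (hτ : 0 < τ.im) {s : ℝ} (hs : 0 < s * ε.re) (β : ℝ) :
    HasSum (fun k : ℕ => dualTerm ε τ (s * k + β))
      ((-I * τ) ^ (1 / 2 : ℂ) * ∫ x : ℝ, waveSum ε τ s β x) := by
  have hr : Real.exp (-(2 * π * (s * ε.re))) < 1 := by
    rw [← norm_exp_two_pi_I_mul ε s 0]; exact norm_exp_two_pi_I_mul_lt_one hs 0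
  have hsum : Summable fun k : ℕ => ∫ x : ℝ, ‖waveTerm ε τ (s * k + β) x‖ := by
    simp only [waveTerm_arith, norm_mul, norm_pow, norm_exp_two_pi_I_mul, integral_mul_const]
    exact (summable_geometric_of_lt_one (Real.exp_pos _).le hr).mul_left _
  have h := hasSum_integral_of_summable_integral_norm
    (fun k : ℕ => integrable_waveTerm hτ ε (s * k + β)) hsum
  have hfun : (fun x : ℝ => ∑' k : ℕ, waveTerm ε τ (s * k + β) x) = waveSum ε τ s β :=
    funext fun x => (hasSum_waveTerm hs τ β x).tsum_eq
  rw [hfun] at h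
  simpa only [integral_waveTerm hτ, mul_inv_cancel_left₀ (cpow_half_ne_zero hτ)] using
    h.mul_left ((-I * τ) ^ (1 / 2 : ℂ))

/-- The geometric series over `k ≥ 0` and over `k < 0` have opposite closed forms. -/
lemma waveSum_neg {ε : ℂ} (hε : ε.re ≠ 0) (τ : ℂ) {s : ℝ} (hs : s ≠ 0) (β x : ℝ) :
    waveSum ε τ (-s) (β - s) x = -waveSum ε τ s β x := by
  have h1 := one_sub_exp_ne_zero hε hs x
  have h2 := one_sub_exp_ne_zero hε (neg_ne_zero.mpr hs) x
  have e1 : waveTerm ε τ (β - s) x =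
      waveTerm ε τ β x * cexp (2 * π * I * (-s : ℝ) * (x + I * ε)) := by
    have := waveTerm_arith ε τ (-s) β x 1
    rw [pow_one] at this
    rw [← this]
    congr 1
    simp
    ring
  have e2 : cexp (2 * π * I * (-s : ℝ) * (x + I * ε)) * cexp (2 * π * I * s * (x + I * ε)) = 1 := by
    rw [← Complex.exp_add, Complex.exp_eq_one_iff]
    exact ⟨0, by push_cast; ring⟩
  rw [waveSum, waveSum, e1, ← neg_div, div_eq_div_iff h2 h1]
  linear_combination -waveTerm ε τ β x * e2

lemma integrable_waveSum_of_re_ne_zero {ε τ : ℂ} (hτ : 0 < τ.im) (hε : ε.re ≠ 0) {s : ℝ}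
    (hs : s ≠ 0) (β : ℝ) : Integrable (waveSum ε τ s β) := by
  rcases (mul_ne_zero hs hε).lt_or_gt with h | h
  · have := integrable_waveSum hτ (s := -s) (ε := ε) (by linarith) (β - s)
    simpa using (this.congr (Filter.Eventually.of_forall fun x => waveSum_neg hε τ hs β x)).neg
  · exact integrable_waveSum hτ h β

/-! ### The two-sided sum -/

/-- The inversion formula for the sum of `dualTerm` over a full arithmetic progression. -/
lemma hasSum_int_dualTerm {ε τ : ℂ} (hτ : 0 < τ.im) {s : ℝ} (hs : 0 < s) (β : ℝ) :
    HasSum (fun k : ℤ => dualTerm ε τ (s * k + β))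
      ((-I * τ) ^ (1 / 2 : ℂ) / s * qPow τ (-ε ^ 2 / 2) *
        jacobiTheta₂ (β / s - I * ε * τ / s) (τ / (s : ℂ) ^ 2)) := by
  have hτ0 : τ ≠ 0 := by rintro rfl; simp at hτ
  have hs0 : (s : ℂ) ≠ 0 := by exact_mod_cast hs.ne'
  have him : 0 < (-(s : ℂ) ^ 2 / τ).im := by
    have : -(s : ℂ) ^ 2 / τ = (s ^ 2 : ℝ) * (-τ⁻¹) := by push_cast; ring
    rw [this, Complex.im_ofReal_mul, Complex.neg_im, Complex.inv_im]
    have : 0 < Complex.normSq τ := Complex.normSq_pos.mpr hτ0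
    have h3 : -(-τ.im / Complex.normSq τ) = τ.im / Complex.normSq τ := by ring
    rw [h3]
    positivity
  have h := (hasSum_jacobiTheta₂_term (I * ε * s - s * β / τ) him).mul_left
    (cexp (-2 * π * ε * β - π * I * (β : ℂ) ^ 2 / τ))
  have hterm (k : ℤ) : dualTerm ε τ (s * k + β) =
      cexp (-2 * π * ε * β - π * I * (β : ℂ) ^ 2 / τ) *
        jacobiTheta₂_term k (I * ε * s - s * β / τ) (-(s : ℂ) ^ 2 / τ) := by
    rw [dualTerm, jacobiTheta₂_term, ← Complex.exp_add]
    congr 1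
    push_cast
    field_simp
    linear_combination -2 * τ * ε * k * s * I_sq
  have hval : (-I * τ) ^ (1 / 2 : ℂ) / s * qPow τ (-ε ^ 2 / 2) *
        jacobiTheta₂ (β / s - I * ε * τ / s) (τ / (s : ℂ) ^ 2) =
      cexp (-2 * π * ε * β - π * I * (β : ℂ) ^ 2 / τ) *
        jacobiTheta₂ (I * ε * s - s * β / τ) (-(s : ℂ) ^ 2 / τ) := by
    rw [jacobiTheta₂_functional_equation (I * ε * s - s * β / τ)]
    have e1 : (-I * (-(s : ℂ) ^ 2 / τ)) ^ (1 / 2 : ℂ) = s * ((-I * τ) ^ (1 / 2 : ℂ))⁻¹ := by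
      have : -I * (-(s : ℂ) ^ 2 / τ) = (s ^ 2 : ℝ) * (-I * τ)⁻¹ := by
        push_cast
        field_simp
        exact I_sq
      have hn : -I * τ ≠ 0 := mul_ne_zero (neg_ne_zero.mpr I_ne_zero) hτ0
      have hsp : (0 : ℝ) < s ^ 2 := by positivity
      have hexp : cexp ((Real.log (s ^ 2) : ℝ) * (1 / 2)) = s := by
        have e : ((2 : ℕ) * Real.log s : ℝ) * (1 / 2 : ℂ) = (Real.log s : ℝ) := by
          push_cast; ring
        rw [Real.log_pow, e, ← Complex.ofReal_exp, Real.exp_log hs]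
      rw [this, Complex.cpow_def_of_ne_zero (mul_ne_zero (by exact_mod_cast hsp.ne')
        (inv_ne_zero hn)), Complex.log_ofReal_mul hsp (inv_ne_zero hn), add_mul, Complex.exp_add,
        ← Complex.cpow_def_of_ne_zero (inv_ne_zero hn), inv_cpow_half hτ, hexp]
    have e2 : (I * ε * s - s * β / τ) / (-(s : ℂ) ^ 2 / τ) = β / s - I * ε * τ / s := by
      field_simp; ring
    have e3 : -1 / (-(s : ℂ) ^ 2 / τ) = τ / (s : ℂ) ^ 2 := by field_simp
    have e4 : qPow τ (-ε ^ 2 / 2) = cexp (-2 * π * ε * β - π * I * (β : ℂ) ^ 2 / τ) *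
        cexp (-π * I * (I * ε * s - s * β / τ) ^ 2 / (-(s : ℂ) ^ 2 / τ)) := by
      rw [qPow, ← Complex.exp_add]
      congr 1
      field_simp
      ring_nf
      simp only [I_sq, I_pow_three]
      ring
    rw [e1, e2, e3, e4]
    have := cpow_half_ne_zero hτ
    field_simp
  rw [hval]
  simpa only [hterm] using h

/-- The sum over `k ≥ 0` for negative `Re ε`: the series in the kernel then converges over the
complementary half `k < 0` of the progression, which contributes the full theta function. -/
lemma tsum_dualTerm_of_re_neg {ε τ : ℂ} (hτ : 0 < τ.im) (hε : ε.re < 0) {s : ℝ} (hs : 0 < s)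
    (β : ℝ) :
    ∑' k : ℕ, dualTerm ε τ (s * k + β) =
      (-I * τ) ^ (1 / 2 : ℂ) * ((∫ x : ℝ, waveSum ε τ s β x) +
        qPow τ (-ε ^ 2 / 2) / s * jacobiTheta₂ (β / s - I * ε * τ / s) (τ / (s : ℂ) ^ 2)) := by
  have hfull := hasSum_int_dualTerm (ε := ε) hτ hs β
  have hneg := hasSum_dualTerm (ε := ε) hτ (s := -s) (by nlinarith) (β - s)
  simp only [waveSum_neg hε.ne τ hs.ne', integral_neg] at hneg
  have hnat : Summable fun k : ℕ => dualTerm ε τ (s * k + β) := by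
    simpa [Function.comp_def] using hfull.summable.comp_injective Nat.cast_injective
  have hneg' : HasSum (fun k : ℕ => dualTerm ε τ (s * (-(k + 1 : ℕ) : ℤ) + β))
      ((-I * τ) ^ (1 / 2 : ℂ) * -∫ x : ℝ, waveSum ε τ s β x) := by
    convert hneg using 3 with k
    push_cast
    ring
  have h := HasSum.of_nat_of_neg_add_one (f := fun k : ℤ => dualTerm ε τ (s * k + β))
    (by simpa only [Int.cast_natCast] using hnat.hasSum) hneg'
  linear_combination h.unique hfull

/-! ### Identification with the characters, kernels and corrections -/

lemma alpha_sq (pp pm : ℕ) : (alpha pp pm : ℂ) ^ 2 = 2 * ((pp * pm : ℕ) : ℂ) := by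
  rw [← Complex.ofReal_pow, alpha, Real.sq_sqrt (by positivity)]
  push_cast; ring

lemma alpha_pos {pp pm : ℕ} (hpp : 1 ≤ pp) (hpm : 1 ≤ pm) : 0 < alpha pp pm := by
  have : (0 : ℝ) < pp := by exact_mod_cast hpp
  have : (0 : ℝ) < pm := by exact_mod_cast hpm
  exact Real.sqrt_pos.mpr (by positivity)

lemma regPartialTheta_neg_one_div {pp pm : ℕ} (hpp : 1 ≤ pp) (hpm : 1 ≤ pm) (ε : ℂ) (d : ℤ)
    (τ : ℂ) :
    regPartialTheta (-(alpha pp pm : ℂ) * ε) (pp * pm) d 0 (-1 / τ) =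
      ∑' k : ℕ, dualTerm ε τ (alpha pp pm * k + d / alpha pp pm) := by
  have hα : (alpha pp pm : ℂ) ≠ 0 := by exact_mod_cast (alpha_pos hpp hpm).ne'
  have hN : ((pp * pm : ℕ) : ℂ) = (alpha pp pm : ℂ) ^ 2 / 2 := by rw [alpha_sq]; ring
  rw [regPartialTheta]
  congr 1
  ext k
  rw [hN, dualTerm, qPow, ← Complex.exp_add, ← Complex.exp_add]
  congr 1
  push_cast
  field_simp
  ring

/-- The integrand is the difference of the two geometric sums of Gaussians. -/
lemma sKernel_mul_fockChar {pp pm : ℕ} (hpp : 1 ≤ pp) (hpm : 1 ≤ pm) {ε : ℂ} (hε : ε.re ≠ 0)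
    (b c : ℤ) (τ : ℂ) (x : ℝ) :
    sKernel pp pm ε b c x * fockChar pp pm ε ((x : ℂ) + (alphaZero pp pm : ℂ) / 2) τ =
      (ModularForm.eta τ)⁻¹ *
        (waveSum ε τ (alpha pp pm) (((b - c : ℤ) : ℝ) / alpha pp pm) x -
          waveSum ε τ (alpha pp pm) (((b + c : ℤ) : ℝ) / alpha pp pm) x) := by
  have hα : (alpha pp pm : ℂ) ≠ 0 := by exact_mod_cast (alpha_pos hpp hpm).ne'
  have hN : (pp : ℂ) * pm = (alpha pp pm : ℂ) ^ 2 / 2 := by rw [alpha_sq]; push_cast; ring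
  have hD := one_sub_exp_ne_zero hε (alpha_pos hpp hpm).ne' x
  rw [sKernel, fockChar, hN]
  simp only [waveSum, waveTerm, add_sub_cancel_right, qPow]
  push_cast
  generalize (alpha pp pm : ℂ) = α at *
  generalize hw : (x : ℂ) + I * ε = w at *
  -- After writing the sines as differences of exponentials, the factor `e ^ (-π i α w)` from the
  -- denominator cancels against the shift of `b` by `p₊p₋`, since `p₊p₋ / α = α / 2`.
  have hsin1 : Complex.sin (2 * π * c * (w / α)) =
      (cexp (-(2 * π * I * (c / α) * w)) - cexp (2 * π * I * (c / α) * w)) * I / 2 := by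
    rw [Complex.sin]
    ring_nf
  have hsin2 : Complex.sin (π * α * w) =
      cexp (-(π * I * α * w)) * (1 - cexp (2 * π * I * α * w)) * I / 2 := by
    rw [Complex.sin, mul_sub, ← Complex.exp_add]
    ring_nf
  have hsplit1 : cexp (2 * π * I * ((b - α ^ 2 / 2) / α) * w) =
      cexp (2 * π * I * (b / α) * w) * cexp (-(π * I * α * w)) := by
    rw [← Complex.exp_add]; congr 1; field_simp; ring
  have hsplit2 : cexp (π * I * τ * (x : ℂ) ^ 2 + 2 * π * I * ((b - c) / α) * w) =
      cexp (2 * π * I * τ * ((x : ℂ) ^ 2 / 2)) * cexp (2 * π * I * (b / α) * w) *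
        cexp (-(2 * π * I * (c / α) * w)) := by
    rw [← Complex.exp_add, ← Complex.exp_add]; congr 1; ring
  have hsplit3 : cexp (π * I * τ * (x : ℂ) ^ 2 + 2 * π * I * ((b + c) / α) * w) =
      cexp (2 * π * I * τ * ((x : ℂ) ^ 2 / 2)) * cexp (2 * π * I * (b / α) * w) *
        cexp (2 * π * I * (c / α) * w) := by
    rw [← Complex.exp_add, ← Complex.exp_add]; congr 1; ring
  have hcancel : cexp (-2 * π * ε * x) * cexp (2 * π * ε * x) = 1 := by
    rw [← Complex.exp_add, Complex.exp_eq_one_iff]; exact ⟨0, by push_cast; ring⟩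
  have hE := Complex.exp_ne_zero (-(π * I * α * w))
  rw [hsin1, hsin2, hsplit1, hsplit2, hsplit3]
  generalize cexp (-(π * I * α * w)) = E at *
  generalize cexp (-2 * π * ε * x) = A at *
  generalize cexp (2 * π * ε * x) = A' at *
  generalize 1 - cexp (2 * π * I * α * w) = D at *
  generalize ModularForm.eta τ = e
  generalize cexp (-(2 * π * I * (c / α) * w)) = u
  generalize cexp (2 * π * I * (c / α) * w) = v
  have : (u - v) * I / 2 / (E * D * I / 2) = (u - v) / (E * D) := by
    field_simp [I_ne_zero]
  rw [this]
  rw [inv_mul_eq_div, div_eq_mul_inv _ e]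
  field_simp
  linear_combination (u - v) * e⁻¹ * hcancel

/-- The `k`-th summand of `θ_{p₊p₋,m}(i α ε τ, τ)` is the summand of index `2 p₊p₋ k + m` of a single
Jacobi theta series. -/
lemma thetaTerm_eq_jacobiTheta₂_term {pp pm : ℕ} (hpp : 1 ≤ pp) (hpm : 1 ≤ pm)
    (ε : ℂ) (m : ℕ) (τ : ℂ) (k : ℤ) :
    cexp (2 * π * I * (I * (alpha pp pm : ℂ) * ε * τ) *
        ((k : ℂ) + ((m : ℤ) : ℂ) / (2 * ((pp * pm : ℕ) : ℂ)))) *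
      qPow τ (((pp * pm : ℕ) : ℂ) * ((k : ℂ) + ((m : ℤ) : ℂ) / (2 * ((pp * pm : ℕ) : ℂ))) ^ 2) =
    jacobiTheta₂_term (k * (2 * pp * pm : ℕ) + m) (I * ε * τ / alpha pp pm)
      (τ / (alpha pp pm : ℂ) ^ 2) := by
  have hα : (alpha pp pm : ℂ) ≠ 0 := by exact_mod_cast (alpha_pos hpp hpm).ne'
  have hN : ((pp * pm : ℕ) : ℂ) = (alpha pp pm : ℂ) ^ 2 / 2 := by rw [alpha_sq]; ring
  have hN' : ((2 * pp * pm : ℕ) : ℂ) = (alpha pp pm : ℂ) ^ 2 := by rw [alpha_sq]; push_cast; ring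
  rw [hN, qPow, jacobiTheta₂_term, ← Complex.exp_add]
  congr 1
  push_cast at hN' ⊢
  rw [hN']
  field_simp

lemma summable_jacobiTheta₂_term_div_alpha_sq {pp pm : ℕ} (hpp : 1 ≤ pp) (hpm : 1 ≤ pm) (z : ℂ)
    {τ : ℂ} (hτ : 0 < τ.im) :
    Summable fun n : ℤ => jacobiTheta₂_term n z (τ / (alpha pp pm : ℂ) ^ 2) := by
  rw [summable_jacobiTheta₂_term_iff]
  have hα := alpha_pos hpp hpm
  rw [← Complex.ofReal_pow, Complex.div_ofReal_im]
  positivity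

/-- A weighted theta series with a weight of period `2 p₊ p₋` splits over residue classes into the
theta functions `θ_{p₊p₋,m}`. -/
lemma sum_mul_theta {pp pm : ℕ} (hpp : 1 ≤ pp) (hpm : 1 ≤ pm) (ε : ℂ) {τ S : ℂ}
    {w : ℤ → ℂ} (hw : ∀ (k : ℤ) (m : ℕ), w (k * (2 * pp * pm : ℕ) + m) = w m)
    (hS : HasSum (fun n : ℤ => w n * jacobiTheta₂_term n (I * ε * τ / alpha pp pm)
      (τ / (alpha pp pm : ℂ) ^ 2)) S) (hτ : 0 < τ.im) :
    ∑ m ∈ Finset.range (2 * pp * pm),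
      w m * theta (pp * pm) m (I * (alpha pp pm : ℂ) * ε * τ) τ = S := by
  have hM : 2 * pp * pm ≠ 0 := by positivity
  have : NeZero (2 * pp * pm) := ⟨hM⟩
  have hS' := (Equiv.prodComm _ _).hasSum_iff.mpr
    ((Int.divModEquiv (2 * pp * pm)).symm.hasSum_iff.mpr hS)
  have hfib (m : Fin (2 * pp * pm)) : HasSum (fun k : ℤ =>
      ((fun n : ℤ => w n * jacobiTheta₂_term n (I * ε * τ / alpha pp pm)
        (τ / (alpha pp pm : ℂ) ^ 2)) ∘ (Int.divModEquiv (2 * pp * pm)).symm)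
        (Equiv.prodComm _ _ (m, k)))
      (w (m : ℕ) * theta (pp * pm) (m : ℕ) (I * (alpha pp pm : ℂ) * ε * τ) τ) := by
    have hinj : Function.Injective fun k : ℤ => k * (2 * pp * pm : ℕ) + ((m : ℕ) : ℤ) := by
      intro k l h
      have hM' : ((2 * pp * pm : ℕ) : ℤ) ≠ 0 := by exact_mod_cast hM
      exact mul_right_cancel₀ hM' (add_right_cancel h)
    have h := (((summable_jacobiTheta₂_term_div_alpha_sq hpp hpm
      (I * ε * τ / alpha pp pm) hτ).comp_injective hinj).hasSum).mul_left (w (m : ℕ))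
    simp only [theta, thetaTerm_eq_jacobiTheta₂_term hpp hpm]
    convert! h using 2 with k
    simp only [Function.comp_apply, Equiv.prodComm_apply, Prod.swap_prod_mk,
      Int.divModEquiv_symm_apply, hw]
  rw [← Fin.sum_univ_eq_sum_range (fun m : ℕ =>
    w m * theta (pp * pm) m (I * (alpha pp pm : ℂ) * ε * τ) τ)]
  exact (hasSum_fintype _).unique (hS'.prod_fiberwise hfib)

/-- The correction term is the difference of the two full theta functions. -/
lemma correction_eq {pp pm : ℕ} (hpp : 1 ≤ pp) (hpm : 1 ≤ pm) (ε : ℂ) (b c : ℤ) {τ : ℂ}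
    (hτ : 0 < τ.im) :
    correction pp pm ε b c τ = (ModularForm.eta τ)⁻¹ * (qPow τ (-ε ^ 2 / 2) / alpha pp pm) *
      (jacobiTheta₂ ((((b - c : ℤ) : ℝ) / alpha pp pm : ℝ) / alpha pp pm -
          I * ε * τ / alpha pp pm) (τ / (alpha pp pm : ℂ) ^ 2) -
        jacobiTheta₂ ((((b + c : ℤ) : ℝ) / alpha pp pm : ℝ) / alpha pp pm -
          I * ε * τ / alpha pp pm) (τ / (alpha pp pm : ℂ) ^ 2)) := by
  have hα : (alpha pp pm : ℂ) ≠ 0 := by exact_mod_cast (alpha_pos hpp hpm).ne'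
  have hN : (pp : ℂ) * pm = (alpha pp pm : ℂ) ^ 2 / 2 := by rw [alpha_sq]; push_cast; ring
  set w : ℤ → ℂ := fun n => 2 * I * cexp (-π * I * ((b : ℂ) * n / ((pp : ℂ) * pm))) *
    Complex.sin (π * ((c : ℂ) * n / ((pp : ℂ) * pm))) with hw
  -- As exponentials, the weight is a difference of two characters of `ℤ / 2 p₊ p₋`.
  have hw' (n : ℤ) : w n = cexp (-(2 * π * I * ((b - c) * n / (alpha pp pm : ℂ) ^ 2))) -
      cexp (-(2 * π * I * ((b + c) * n / (alpha pp pm : ℂ) ^ 2))) := by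
    have e1 : cexp (-(2 * π * I * ((b - c) * n / (alpha pp pm : ℂ) ^ 2))) =
        cexp (-π * I * ((b : ℂ) * n / ((pp : ℂ) * pm))) *
          cexp (π * ((c : ℂ) * n / ((pp : ℂ) * pm)) * I) := by
      rw [← Complex.exp_add, hN]; congr 1; field_simp; ring
    have e2 : cexp (-(2 * π * I * ((b + c) * n / (alpha pp pm : ℂ) ^ 2))) =
        cexp (-π * I * ((b : ℂ) * n / ((pp : ℂ) * pm))) *
          cexp (-(π * ((c : ℂ) * n / ((pp : ℂ) * pm))) * I) := by
      rw [← Complex.exp_add, hN]; congr 1; field_simp; ring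
    simp only [hw]
    rw [e1, e2, Complex.sin]
    linear_combination (cexp (-π * I * ((b : ℂ) * n / ((pp : ℂ) * pm)))) *
      (cexp (-(π * ((c : ℂ) * n / ((pp : ℂ) * pm))) * I) -
        cexp (π * ((c : ℂ) * n / ((pp : ℂ) * pm)) * I)) * I_sq
  have hper (k : ℤ) (m : ℕ) : w (k * (2 * pp * pm : ℕ) + m) = w m := by
    have hN' : ((2 * pp * pm : ℕ) : ℂ) = (alpha pp pm : ℂ) ^ 2 := by
      rw [alpha_sq]; push_cast; ring
    have key (d : ℤ) : cexp (-(2 * π * I * (d * ((k * (2 * pp * pm : ℕ) + m : ℤ) : ℂ) /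
        (alpha pp pm : ℂ) ^ 2))) =
        cexp (-(2 * π * I * (d * ((m : ℤ) : ℂ) / (alpha pp pm : ℂ) ^ 2))) := by
      rw [Complex.exp_eq_exp_iff_exists_int]
      refine ⟨-(d * k), ?_⟩
      rw [Int.cast_add, Int.cast_mul, Int.cast_natCast (2 * pp * pm), hN']
      push_cast
      field_simp
      ring
    have k1 := key (b - c)
    have k2 := key (b + c)
    rw [hw', hw']
    push_cast at k1 k2 ⊢
    rw [k1, k2]
  have hth (d : ℤ) : HasSum (fun n : ℤ => cexp (-(2 * π * I * (d * n / (alpha pp pm : ℂ) ^ 2))) *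
      jacobiTheta₂_term n (I * ε * τ / alpha pp pm) (τ / (alpha pp pm : ℂ) ^ 2))
      (jacobiTheta₂ (((d : ℝ) / alpha pp pm : ℝ) / alpha pp pm -
          I * ε * τ / alpha pp pm) (τ / (alpha pp pm : ℂ) ^ 2)) := by
    rw [← jacobiTheta₂_neg_left, neg_sub]
    have h := (summable_jacobiTheta₂_term_div_alpha_sq hpp hpm (I * ε * τ / alpha pp pm -
      ((d : ℝ) / alpha pp pm : ℝ) / alpha pp pm) hτ).hasSum
    rw [← jacobiTheta₂] at h
    convert! h using 2 with n
    rw [jacobiTheta₂_term, jacobiTheta₂_term, ← Complex.exp_add]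
    congr 1
    push_cast
    field_simp
    ring
  have hS := (hth (b - c)).sub (hth (b + c))
  simp only [← sub_mul] at hS
  have h := sum_mul_theta hpp hpm ε hper
    (hS.congr_fun fun n => by rw [hw']; push_cast; rfl) hτ
  rw [correction, ← h, Finset.mul_sum, Finset.mul_sum]
  refine Finset.sum_congr rfl fun m _ => ?_
  simp only [hw, Int.cast_natCast]
  ring

end Singlet

theorem mainTheorem1 (pp pm : ℕ) (hpp : 1 ≤ pp) (hpm : 1 ≤ pm) (hne : pp ≠ pm)
    (hcop : Nat.Coprime pp pm) (b c : ℤ) (hc : c ≠ 0) (ε : ℂ) (hε : ε.re ≠ 0)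
    (τ : ℂ) (hτ : 0 < τ.im) :
    Integrable (fun x : ℝ => Singlet.sKernel pp pm ε b c x *
        Singlet.fockChar pp pm ε ((x : ℂ) + (Singlet.alphaZero pp pm : ℂ) / 2) τ) volume ∧
      Singlet.mixedFalseTheta pp pm ε b c (-1 / τ) =
        (∫ x : ℝ, Singlet.sKernel pp pm ε b c x *
          Singlet.fockChar pp pm ε ((x : ℂ) + (Singlet.alphaZero pp pm : ℂ) / 2) τ) +
        ((1 - (Real.sign ε.re : ℂ)) / 2) * Singlet.correction pp pm ε b c τ := by
  have hη := ModularForm.eta_ne_zero (z := τ) hτ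
  have hα := Singlet.alpha_pos hpp hpm
  have hsqrt := Singlet.cpow_half_ne_zero hτ
  have hint (d : ℤ) := Singlet.integrable_waveSum_of_re_ne_zero hτ hε hα.ne'
    ((d : ℝ) / Singlet.alpha pp pm)
  simp only [Singlet.sKernel_mul_fockChar hpp hpm hε]
  refine ⟨((hint (b - c)).sub (hint (b + c))).const_mul _, ?_⟩
  rw [integral_const_mul, integral_sub (hint (b - c)) (hint (b + c)), Singlet.mixedFalseTheta,
    Singlet.eta_neg_one_div hτ, Singlet.regPartialTheta_neg_one_div hpp hpm,
    Singlet.regPartialTheta_neg_one_div hpp hpm]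
  -- For `Re ε < 0` the two full theta functions make up the correction term; for `Re ε > 0` the
  -- geometric series in the kernel converges as it stands.
  rcases hε.lt_or_gt with h | h
  · rw [Singlet.tsum_dualTerm_of_re_neg hτ h hα, Singlet.tsum_dualTerm_of_re_neg hτ h hα,
      Singlet.correction_eq hpp hpm ε b c hτ, Real.sign_of_neg h]
    generalize (-I * τ) ^ (1 / 2 : ℂ) = r at *
    simp only [Complex.ofReal_neg, Complex.ofReal_one]
    field_simp
    ring
  · have hs := mul_pos hα h
    rw [(Singlet.hasSum_dualTerm hτ hs _).tsum_eq, (Singlet.hasSum_dualTerm hτ hs _).tsum_eq,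
      Real.sign_of_pos h]
    generalize (-I * τ) ^ (1 / 2 : ℂ) = r at *
    simp only [Complex.ofReal_one]
    field_simp
    ring
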